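/- Let $d\in\mathbb N$ and let $\Gamma\subset\mathbb R^{2d}\times\mathbb R$ be a lattice (a discrete subgroup spanning $\mathbb R^{2d}\times\mathbb R$), with covolume $\mathrm{vol}(\Gamma)$ and dual lattice $$\Gamma^*=\{\eta : \gamma\cdot\eta\in\mathbb Z \text{ for all }\gamma\in\Gamma\}.$$ Let $p_1,p_2$ be the projections of $\mathbb R^{2d}\times\mathbb R$ onto $\mathbb R^{2d}$ and $\mathbb R$, and assume that $p_1|_\Gamma$ and $p_2|_\Gamma$ are injective with dense images. Let $\Omega\subset\mathbb R$ be relatively compact with non-empty interior, let $$\Lambda(\Omega)=\{p_1(\gamma):\gamma\in\Gamma,\ p_2(\gamma)\in\Omega\}$$ be the associated simple model set, let $\psi:\mathbb R\to\mathbb R$ be smooth with support contained in $\Omega$, and put $w_\psi(p_1(\gamma))=\psi(p_2(\gamma))$ for $p_1(\gamma)\in\Lambda(\Omega)$, $\gamma\in\Gamma$, and $w_\psi=0$ off $\Lambda(\Omega)$. Write $\widehat f(\zeta)=\int f(t)e^{-2\pi i t\cdot\zeta}\,dt$ and $\widetilde w_\psi(s)=\mathrm{vol}(\Gamma)^{-1}\,\widehat\psi(s)$.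 Let $M^1(\mathbb R^{2d})$ be Feichtinger's algebra, i.e. the tempered distributions $T$ such that the short-time Fourier transform $(x,\xi)\mapsto\langle T,\ e^{2\pi i\xi\cdot}\,g(\cdot-x)\rangle$ is integrable on $\mathbb R^{2d}\times\mathbb R^{2d}$ for a non-zero Schwartz window $g$; its elements are, as usual, regarded as continuous functions on $\mathbb R^{2d}$. **Theorem (Poisson summation for simple model sets).** Every $F\in M^1(\mathbb R^{2d})$ is integrable, and for all $z\in\mathbb R^{2d}$ $$\sum_{\lambda\in\Lambda(\Omega)} w_\psi(\lambda)F(\lambda)e^{-2\pi i\lambda\cdot z}=\sum_{\gamma^*\in\Gamma^*}\widetilde w_\psi(-p_2(\gamma^*))\,\widehat F(z-p_1(\gamma^*)).$$ Both series converge absolutely for every $z\in\mathbb R^{2d}$. The series on the left converges uniformly on $\mathbb R^{2d}$. The series on the right converges uniformly on compact subsets of $\mathbb R^{2d}$; moreover its convergence is uniform on all of $\mathbb R^{2d}$ for truncations centred at $z$: for every $\varepsilon>0$ there is an $R$ such that for all $z\in\mathbb R^{2d}$ $$\sum_{\gamma^*\in\Gamma^*,\ \mathrm{dist}(\gamma^*,(z,0))>R}\bigl|\widetilde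 w_\psi(-p_2(\gamma^*))\,\widehat F(z-p_1(\gamma^*))\bigr|\le\varepsilon,$$ where $\mathrm{dist}$ is the distance given by $\max(|x|,|t|)$ on $\mathbb R^{2d}\times\mathbb R$. -/

import Mathlib

open MeasureTheory Filter Topology
open scoped SchwartzMap FourierTransform ContDiff

noncomputable section

/-! ### Time-frequency shifts, the short-time Fourier transform and Feichtinger's algebra -/

/-- The oscillation `s ↦ exp (2 π i s)` has temperate growth. -/
theorem expTwoPiI_hasTemperateGrowth :
    Function.HasTemperateGrowth
      (fun s : ℝ => Complex.exp (2 * Real.pi * Complex.I * (s : ℂ))) := by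
  have key : ∀ n : ℕ, iteratedDeriv n
      (fun s : ℝ => Complex.exp (2 * Real.pi * Complex.I * (s : ℂ))) =
      fun s : ℝ => (2 * Real.pi * Complex.I) ^ n *
        Complex.exp (2 * Real.pi * Complex.I * (s : ℂ)) := by
    intro n
    induction n with
    | zero => simp
    | succ n ih =>
      rw [iteratedDeriv_succ, ih]
      funext s
      have h1 : HasDerivAt (fun s : ℝ => 2 * Real.pi * Complex.I * (s : ℂ))
          (2 * Real.pi * Complex.I * 1) s :=
        (Complex.ofRealCLM.hasDerivAt (x := s)).const_mul _
      have h2 := (h1.cexp).const_mul ((2 * Real.pi * Complex.I) ^ n)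
      rw [h2.deriv]
      ring
  refine ⟨Complex.contDiff_exp.comp (contDiff_const.mul Complex.ofRealCLM.contDiff), fun n => ⟨0, (2 * Real.pi) ^ n, fun s => ?_⟩⟩
  rw [norm_iteratedFDeriv_eq_norm_iteratedDeriv, key n]
  have h3 : ‖Complex.exp (2 * Real.pi * Complex.I * (s : ℂ))‖ = 1 := by
    have : (2 * Real.pi * Complex.I * (s : ℂ)) = ((2 * Real.pi * s : ℝ) : ℂ) * Complex.I := by
      push_cast; ring
    rw [this, Complex.norm_exp_ofReal_mul_I]
  simp [h3, abs_of_pos Real.pi_pos]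

section TimeFrequency

variable {E : Type*} [NormedAddCommGroup E] [InnerProductSpace ℝ E]

/-- The character `t ↦ exp (2 π i ξ · t)`. -/
def modChar (ξ : E) (t : E) : ℂ :=
  Complex.exp (2 * Real.pi * Complex.I * ((inner ℝ ξ t : ℝ) : ℂ))

theorem modChar_hasTemperateGrowth (ξ : E) : Function.HasTemperateGrowth (modChar ξ) :=
  expTwoPiI_hasTemperateGrowth.comp (Function.hasTemperateGrowth_inner_right ξ)

/-- The time-frequency shift `π(x, ξ) g = M_ξ T_x g` of a Schwartz function,
that is `t ↦ exp (2 π i ξ · t) g (t - x)`. -/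
def tfShift (x ξ : E) (g : 𝓢(E, ℂ)) : 𝓢(E, ℂ) :=
  SchwartzMap.smulLeftCLM ℂ (modChar ξ) (SchwartzMap.compSubConstCLM ℂ x g)

theorem tfShift_apply (x ξ : E) (g : 𝓢(E, ℂ)) (t : E) :
    tfShift x ξ g t = modChar ξ t * g (t - x) := by
  simp [tfShift, SchwartzMap.smulLeftCLM_apply_apply (modChar_hasTemperateGrowth ξ)]

/-- The complex conjugate of a Schwartz function. -/
def conjSchwartz (g : 𝓢(E, ℂ)) : 𝓢(E, ℂ) :=
  SchwartzMap.postcompCLM (𝕜 := ℝ) (Complex.conjCLE : ℂ →L[ℝ] ℂ) g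

theorem conjSchwartz_apply (g : 𝓢(E, ℂ)) (t : E) :
    conjSchwartz g t = (starRingEnd ℂ) (g t) := rfl

/-- The short-time Fourier transform `V_g T (x, ξ) = ⟨T, π(x, ξ) g⟩` of a tempered distribution `T`
with respect to a Schwartz window `g`; the bracket is conjugate linear in the second entry. -/
def stft (g : 𝓢(E, ℂ)) (T : 𝓢'(E, ℂ)) (z : E × E) : ℂ :=
  T (conjSchwartz (tfShift z.1 z.2 g))

end TimeFrequency

/-- The modulation space `M¹` (Feichtinger's algebra): all tempered distributions whose short-time
Fourier transform is integrable over phase space, for a nonzero Schwartz window. (All nonzero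
Schwartz windows give the same space; membership is asked for just one of them.) -/
def feichtingerAlgebra (E : Type*) [NormedAddCommGroup E] [InnerProductSpace ℝ E]
    [FiniteDimensional ℝ E] [MeasurableSpace E] [BorelSpace E] : Set 𝓢'(E, ℂ) :=
  {T | ∃ g : 𝓢(E, ℂ), g ≠ 0 ∧ Integrable (stft g T) (volume : Measure (E × E))}

/-- `F` is a function in `M¹`: a continuous function such that the tempered distribution
`φ ↦ ∫ F φ` which it defines belongs to `M¹`. -/
def MemM1 {E : Type*} [NormedAddCommGroup E] [InnerProductSpace ℝ E]
    [FiniteDimensional ℝ E] [MeasurableSpace E] [BorelSpace E] (F : E → ℂ) : Prop :=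
  Continuous F ∧ ∃ T ∈ feichtingerAlgebra E, ∀ φ : 𝓢(E, ℂ),
    Integrable (fun t => F t * φ t) volume ∧ T φ = ∫ t, F t * φ t

/-! ### Simple model sets -/

section ModelSets

variable {E : Type*} [NormedAddCommGroup E]

/-- The standing conditions on the lattice of a model set: each of the two projections is injective
on `Γ` and has dense image. -/
structure IsModelSetLattice (Γ : Submodule ℤ (E × ℝ)) : Prop where
  injOn_fst : Set.InjOn (Prod.fst : E × ℝ → E) (Γ : Set (E × ℝ))
  dense_fst : Dense ((Prod.fst : E × ℝ → E) '' (Γ : Set (E × ℝ)))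
  injOn_snd : Set.InjOn (Prod.snd : E × ℝ → ℝ) (Γ : Set (E × ℝ))
  dense_snd : Dense ((Prod.snd : E × ℝ → ℝ) '' (Γ : Set (E × ℝ)))

/-- The simple model set `Λ(Ω) = {p₁(γ) : γ ∈ Γ, p₂(γ) ∈ Ω}`. -/
def modelSet (Γ : Submodule ℤ (E × ℝ)) (Ω : Set ℝ) : Set E :=
  {l | ∃ γ ∈ Γ, γ.2 ∈ Ω ∧ γ.1 = l}

open Classical in
/-- The weight `w_ψ`: it is `ψ(p₂(γ))` at a point `p₁(γ)` of `Λ(Ω)` and `0` off `Λ(Ω)`. -/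
def modelWeight (Γ : Submodule ℤ (E × ℝ)) (Ω : Set ℝ) (ψ : ℝ → ℝ) (l : E) : ℝ :=
  if h : ∃ γ ∈ Γ, γ.2 ∈ Ω ∧ γ.1 = l then ψ h.choose.2 else 0

/-- The weight does not depend on choices. -/
theorem modelWeight_apply {Γ : Submodule ℤ (E × ℝ)} (hΓ : IsModelSetLattice Γ) {Ω : Set ℝ}
    (ψ : ℝ → ℝ) {γ : E × ℝ} (hγ : γ ∈ Γ) (hΩ : γ.2 ∈ Ω) :
    modelWeight Γ Ω ψ γ.1 = ψ γ.2 := by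
  have h : ∃ γ' ∈ Γ, γ'.2 ∈ Ω ∧ γ'.1 = γ.1 := ⟨γ, hγ, hΩ, rfl⟩
  rw [modelWeight, dif_pos h, hΓ.injOn_fst h.choose_spec.1 hγ h.choose_spec.2.2]

variable [InnerProductSpace ℝ E]

/-- The dual lattice: all `η` with `γ · η ∈ ℤ` for every `γ ∈ Γ`, where
`γ · η = γ.1 · η.1 + γ.2 η.2` is the inner product of the orthogonal sum of `E` and `ℝ`. -/
def dualLattice (Γ : Submodule ℤ (E × ℝ)) : Submodule ℤ (E × ℝ) where
  carrier := {η | ∀ γ ∈ Γ, ∃ n : ℤ, inner ℝ γ.1 η.1 + γ.2 * η.2 = (n : ℝ)}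
  add_mem' := by
    intro a b ha hb γ hγ
    obtain ⟨m, hm⟩ := ha γ hγ
    obtain ⟨n, hn⟩ := hb γ hγ
    refine ⟨m + n, ?_⟩
    push_cast
    rw [← hm, ← hn, Prod.fst_add, Prod.snd_add, inner_add_right]
    ring
  zero_mem' := fun γ _ => ⟨0, by simp⟩
  smul_mem' := by
    intro c a ha γ hγ
    obtain ⟨m, hm⟩ := ha γ hγ
    refine ⟨c * m, ?_⟩
    push_cast
    rw [← hm, Prod.smul_fst, Prod.smul_snd, ← Int.cast_smul_eq_zsmul ℝ c a.1, inner_smul_right]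
    simp only [zsmul_eq_mul]
    ring

/-- The dual weight `w̃_ψ = vol(Γ)⁻¹ ψ̂`. -/
def dualWeight [FiniteDimensional ℝ E] [MeasurableSpace E] [BorelSpace E]
    (Γ : Submodule ℤ (E × ℝ)) (ψ : ℝ → ℝ) (s : ℝ) : ℂ :=
  ((ZLattice.covolume Γ volume)⁻¹ : ℝ) * 𝓕 (fun t : ℝ => (ψ t : ℂ)) s

/-- The term `w_ψ(λ) F(λ) exp(-2 π i λ · z)`. -/
def modelSetTerm (Γ : Submodule ℤ (E × ℝ)) (Ω : Set ℝ) (ψ : ℝ → ℝ) (F : E → ℂ)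
    (l : E) (z : E) : ℂ :=
  (modelWeight Γ Ω ψ l : ℂ) * F l *
    Complex.exp (-(2 * Real.pi * Complex.I * ((inner ℝ l z : ℝ) : ℂ)))

/-- The term `w̃_ψ(-p₂(η)) F̂(z - p₁(η))` for a point `η` of the dual lattice. -/
def dualTerm [FiniteDimensional ℝ E] [MeasurableSpace E] [BorelSpace E]
    (Γ : Submodule ℤ (E × ℝ)) (ψ : ℝ → ℝ) (F : E → ℂ) (η : E × ℝ) (z : E) : ℂ :=
  dualWeight Γ ψ (-η.2) * 𝓕 F (z - η.1)

end ModelSets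

end

/-! Since `p₁` is injective on `Γ` and `ψ` vanishes off `Ω`, the left side is the sum of `(F ⊗
ψ)(γ)` over `Γ`, twisted by a character, and the claim is formally Poisson summation in `E × ℝ`. The
difficulty is that `F` need not decay pointwise.

For a product of Schwartz functions, Poisson summation is classical
(`ZLattice.tsum_schwartz_mul_schwartz`): the periodization descends to a torus and its Fourier
series is evaluated at `0`. Inverting the short-time Fourier transform writes `F = ∫ V(x, ξ) π(x,
ξ)g` with `V` integrable and `g` Schwartz (`MemM1.exists_eq_integral_tfShift`), so the formula can
be integrated over the atoms `π(x, ξ)g`. The interchange is legitimate because atoms have moduli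
that are translates of `|g|`, and their transforms translates of `|ĝ|`, while lattice sums of
translates of a rapidly decaying function are uniformly bounded
(`ZLattice.exists_summable_tsum_inv_one_add_norm_sub_le`).

For the dual tails, the transform of an atom is concentrated near frequency `ξ`. Beyond distance `R`
from `(z, 0)` its lattice sum is at most `C / (1 + max(0, R - |ξ|))`, whatever `z` and `x` are;
integrated against `|V|` this tends to `0` by dominated convergence. Uniformity on compact sets
follows, because for bounded `z` the points far from the origin are far from `(z, 0)`. On the left,
the moduli of the terms do not depend on `z`. -/

/-! ### Uniform bounds for lattice sums -/

section LatticeSums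

variable {V : Type*} [NormedAddCommGroup V]

/-- Peetre's inequality for the weight `(1 + ‖·‖) ^ N`. -/
theorem inv_one_add_norm_add_pow_le (N : ℕ) (x y : V) :
    ((1 + ‖x + y‖) ^ N)⁻¹ ≤ (1 + ‖x‖) ^ N * ((1 + ‖y‖) ^ N)⁻¹ := by
  rw [← div_eq_mul_inv, inv_eq_one_div, div_le_div_iff₀ (by positivity) (by positivity), one_mul,
    ← mul_pow]
  gcongr
  have h : ‖y‖ ≤ ‖x + y‖ + ‖x‖ := by
    simpa [add_sub_cancel_left] using norm_sub_le (x + y) x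
  nlinarith [norm_nonneg x, norm_nonneg (x + y), mul_nonneg (norm_nonneg x) (norm_nonneg (x + y))]

variable [NormedSpace ℝ V] [FiniteDimensional ℝ V] (L : Submodule ℤ V) [DiscreteTopology L]

theorem ZLattice.summable_inv_one_add_norm_pow [IsZLattice ℝ L] {N : ℕ}
    (hN : Module.finrank ℝ V < N) :
    Summable fun γ : L => ((1 + ‖(γ : V)‖) ^ N)⁻¹ := by
  rw [← ZLattice.rank ℝ L] at hN
  -- The majorant is `0` at `γ = 0`, where the comparison fails; a cofinite comparison is enough.
  refine Summable.of_norm_bounded_eventually (ZLattice.summable_norm_pow_inv L N hN) ?_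
  have h : (cofinite : Filter L) ≤ 𝓟 {0}ᶜ := by
    rw [le_principal_iff]
    exact (Set.finite_singleton (0 : L)).compl_mem_cofinite
  filter_upwards [h (mem_principal_self _)] with γ hγ
  have : 0 < ‖(γ : V)‖ := by simpa using hγ
  rw [Real.norm_of_nonneg (by positivity), ← inv_pow]
  gcongr
  · simp

/-- The sums of `(1 + ‖γ - u‖) ^ (-N)` over a lattice are bounded uniformly in `u`. -/
theorem ZLattice.exists_summable_tsum_inv_one_add_norm_sub_le [IsZLattice ℝ L] {N : ℕ}
    (hN : Module.finrank ℝ V < N) :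
    ∃ C : ℝ, 0 ≤ C ∧ ∀ u : V, Summable (fun γ : L => ((1 + ‖(γ : V) - u‖) ^ N)⁻¹) ∧
      ∑' γ : L, ((1 + ‖(γ : V) - u‖) ^ N)⁻¹ ≤ C := by
  let b := Module.Free.chooseBasis ℤ L
  let B := b.ofZLatticeBasis ℝ L
  have hB : Submodule.span ℤ (Set.range B) = L := b.ofZLatticeBasis_span ℝ
  set D : ℝ := ∑ i, ‖B i‖
  have hD : 0 ≤ D := by positivity
  have hs := ZLattice.summable_inv_one_add_norm_pow L hN
  refine ⟨(1 + D) ^ N * ∑' γ : L, ((1 + ‖(γ : V)‖) ^ N)⁻¹, by positivity, fun u => ?_⟩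
  -- Re-indexing by `γ₀` replaces `u` by its fractional part, whose norm is at most `D`, so the
  -- bound no longer depends on `u`.
  let γ₀ : L := ⟨ZSpan.floor B u, hB.le (ZSpan.floor B u).2⟩
  have hle : ∀ γ : L, ((1 + ‖((γ + γ₀ : L) : V) - u‖) ^ N)⁻¹ ≤
      (1 + D) ^ N * ((1 + ‖(γ : V)‖) ^ N)⁻¹ := by
    intro γ
    have h1 : ((γ + γ₀ : L) : V) - u = -ZSpan.fract B u + γ := by
      simp only [ZSpan.fract, γ₀, Submodule.coe_add]; abel
    rw [h1]
    refine (inv_one_add_norm_add_pow_le N _ _).trans ?_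
    gcongr
    rw [norm_neg]
    exact ZSpan.norm_fract_le B u
  have hs' := Summable.of_nonneg_of_le (fun γ => by positivity) hle (hs.mul_left _)
  refine ⟨(Equiv.addRight γ₀).summable_iff.mp hs', ?_⟩
  rw [← (Equiv.addRight γ₀).tsum_eq, ← tsum_mul_left]
  exact hs'.tsum_le_tsum hle (hs.mul_left _)

end LatticeSums

/-! ### Poisson summation by periodization -/

section Poisson

theorem UnitAddTorus.mFourier_neg_coe {ι : Type*} [Fintype ι] (k : ι → ℤ) (u : ι → ℝ) :
    UnitAddTorus.mFourier (-k) (fun i => (u i : UnitAddCircle)) =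
      Complex.exp (-(2 * Real.pi * Complex.I * ((∑ i, k i * u i : ℝ) : ℂ))) := by
  simp only [UnitAddTorus.mFourier, ContinuousMap.coe_mk, fourier_coe_apply, ← Complex.exp_sum]
  congr 1
  push_cast
  rw [Finset.mul_sum, ← Finset.sum_neg_distrib]
  refine Finset.sum_congr rfl fun i _ => ?_
  simp only [Pi.neg_apply, Int.cast_neg]
  ring

variable {V : Type*} [NormedAddCommGroup V] [NormedSpace ℝ V] [FiniteDimensional ℝ V]
  [MeasurableSpace V] [BorelSpace V]

omit [FiniteDimensional ℝ V] in
/-- In coordinates with respect to a basis, the unit cube corresponds to the fundamental domain. -/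
theorem ZSpan.setIntegral_fundamentalDomain_comp_equivFun {ι : Type*} [Fintype ι]
    (B : Module.Basis ι ℝ V) (μ : Measure V) [μ.IsAddHaarMeasure] (h : (ι → ℝ) → ℂ) :
    ∫ v in ZSpan.fundamentalDomain B, h (B.equivFun v) ∂μ =
      (μ.real (ZSpan.fundamentalDomain B) : ℂ) *
        ∫ u in {u : ι → ℝ | ∀ i, u i ∈ Set.Ioc (0 : ℝ) (0 + 1)}, h u := by
  let e : V ≃L[ℝ] (ι → ℝ) := B.equivFunL
  have he : MeasurableEmbedding e := e.toHomeomorph.measurableEmbedding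
  set Q : Set (ι → ℝ) := Set.univ.pi fun _ => Set.Ico 0 1
  have hQ : ZSpan.fundamentalDomain B = e ⁻¹' Q := by
    ext v
    simp [ZSpan.mem_fundamentalDomain, Q, Set.mem_pi, e, Module.Basis.equivFunL]
  have hvQ : volume Q = 1 := by simp [Q, volume_pi_pi]
  have hQ' : {u : ι → ℝ | ∀ i, u i ∈ Set.Ioc (0 : ℝ) (0 + 1)} =ᵐ[volume] Q := by
    have h1 : {u : ι → ℝ | ∀ i, u i ∈ Set.Ioc (0 : ℝ) (0 + 1)} =
        Set.univ.pi fun _ => Set.Ioc 0 1 := by ext; simp [Set.mem_pi]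
    rw [h1]
    exact Measure.univ_pi_Ioc_ae_eq_Icc.trans Measure.univ_pi_Ico_ae_eq_Icc.symm
  -- By uniqueness of Haar measure the pushforward of `μ` is a multiple of Lebesgue measure; the
  -- unit cube, of volume one, identifies the factor.
  have hmap := Measure.isAddLeftInvariant_eq_smul (μ.map e) (volume : Measure (ι → ℝ))
  set c := Measure.addHaarScalarFactor (μ.map e) (volume : Measure (ι → ℝ))
  have hc : μ.real (ZSpan.fundamentalDomain B) = c := by
    rw [hQ, measureReal_def, ← he.map_apply, hmap, Measure.smul_apply, hvQ]
    simp [ENNReal.smul_def]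
  rw [setIntegral_congr_set hQ', hc, hQ]
  have := he.setIntegral_map (μ := μ) h Q
  rw [hmap, Measure.restrict_smul, integral_smul_nnreal_measure] at this
  rw [NNReal.smul_def, Complex.real_smul] at this
  exact this.symm

variable (L : Submodule ℤ V) [DiscreteTopology L] [IsZLattice ℝ L]

omit [MeasurableSpace V] [BorelSpace V] in
-- On a unit ball about `v₀`, Peetre's inequality with `1 + ‖v‖ ≤ 2 + ‖v₀‖` gives a summable
-- majorant independent of `v`.
theorem ZLattice.continuous_tsum_add {G : V → ℂ} (hG : Continuous G) {N : ℕ}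
    (hN : Module.finrank ℝ V < N) {C : ℝ} (hC : ∀ v, ‖G v‖ ≤ C * ((1 + ‖v‖) ^ N)⁻¹) :
    Continuous fun v => ∑' γ : L, G (v + γ) := by
  have hC0 : 0 ≤ C := by
    have := (norm_nonneg _).trans (hC 0)
    simpa using this
  rw [continuous_iff_continuousAt]
  intro v₀
  refine (continuousOn_tsum (s := Metric.ball v₀ 1)
    (u := fun γ : L => C * ((2 + ‖v₀‖) ^ N * ((1 + ‖(γ : V)‖) ^ N)⁻¹)) (fun γ => by fun_prop)
    (((ZLattice.summable_inv_one_add_norm_pow L hN).mul_left _).mul_left _)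
    fun γ v hv => (hC _).trans ?_).continuousAt (Metric.ball_mem_nhds _ one_pos)
  gcongr
  refine (inv_one_add_norm_add_pow_le N _ _).trans ?_
  refine mul_le_mul_of_nonneg_right (pow_le_pow_left₀ (by positivity) ?_ N) (by positivity)
  have : ‖v‖ ≤ ‖v₀‖ + 1 := by
    rw [Metric.mem_ball, dist_eq_norm] at hv
    have := norm_add_le v₀ (v - v₀)
    rw [add_sub_cancel] at this
    linarith
  linarith

open UnitAddTorus in
/-- **Poisson summation** over a lattice, in terms of the coordinates of a `ℤ`-basis. -/
theorem ZLattice.tsum_eq_tsum_integral {ι : Type*} [Fintype ι] (b : Module.Basis ι ℤ L)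
    (μ : Measure V) [μ.IsAddHaarMeasure] {G : V → ℂ} (hG : Continuous G) {N : ℕ}
    (hN : Module.finrank ℝ V < N) {C : ℝ} (hC : ∀ v, ‖G v‖ ≤ C * ((1 + ‖v‖) ^ N)⁻¹)
    (hs : Summable fun k : ι → ℤ => ∫ v, Complex.exp (-(2 * Real.pi * Complex.I *
      ((∑ i, k i * (b.ofZLatticeBasis ℝ L).repr v i : ℝ) : ℂ))) * G v ∂μ) :
    ∑' γ : L, G γ = ((ZLattice.covolume L μ)⁻¹ : ℝ) *
      ∑' k : ι → ℤ, ∫ v, Complex.exp (-(2 * Real.pi * Complex.I *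
        ((∑ i, k i * (b.ofZLatticeBasis ℝ L).repr v i : ℝ) : ℂ))) * G v ∂μ := by
  set B := b.ofZLatticeBasis ℝ L with hBdef
  set e : (ι → ℤ) → V → ℂ := fun k v => Complex.exp (-(2 * Real.pi * Complex.I *
      ((∑ i, k i * B.repr v i : ℝ) : ℂ))) with hedef
  have hcont : Continuous fun v => B.equivFun v := B.equivFunL.continuous
  have hcont' : Continuous fun u => B.equivFun.symm u := B.equivFunL.symm.continuous
  have he_cont : ∀ k, Continuous (e k) := by
    intro k
    have : ∀ i, Continuous fun v => B.repr v i := fun i => (continuous_apply i).comp hcont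
    simp only [hedef]
    fun_prop
  have he_norm : ∀ k v, ‖e k v‖ = 1 := by
    intro k v
    have : -(2 * Real.pi * Complex.I * ((∑ i, k i * B.repr v i : ℝ) : ℂ)) =
      ((-(2 * Real.pi * ∑ i, k i * B.repr v i) : ℝ) : ℂ) * Complex.I := by push_cast; ring
    simp only [hedef]
    rw [this, Complex.norm_exp_ofReal_mul_I]
  have he_add : ∀ k (v : V) (γ : L), e k (v + γ) = e k v := by
    intro k v γ
    have h1 : -(2 * Real.pi * Complex.I * ((∑ i, k i * B.repr (v + γ) i : ℝ) : ℂ)) =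
        -(2 * Real.pi * Complex.I * ((∑ i, k i * B.repr v i : ℝ) : ℂ)) +
          ((-∑ i, k i * b.repr γ i : ℤ) : ℂ) * (2 * Real.pi * Complex.I) := by
      have h2 : ∀ i, B.repr (γ : V) i = b.repr γ i := fun i => by
        rw [hBdef, b.ofZLatticeBasis_repr_apply ℝ]
      simp only [map_add, Finsupp.add_apply, h2, mul_add, Finset.sum_add_distrib]
      push_cast
      ring
    simp only [hedef]
    rw [h1, Complex.exp_add, Complex.exp_int_mul_two_pi_mul_I, mul_one]
  have hC0 : 0 ≤ C := by
    have := (norm_nonneg _).trans (hC 0)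
    simpa using this
  have hGint : Integrable G μ := by
    have h1 : Integrable (fun v : V => C * (1 + ‖v‖) ^ (-(N : ℝ))) μ :=
      (integrable_one_add_norm (by exact_mod_cast hN)).const_mul C
    refine h1.mono' hG.aestronglyMeasurable (.of_forall fun v => (hC v).trans_eq ?_)
    rw [Real.rpow_neg (by positivity), Real.rpow_natCast]
  have heG : ∀ k, Integrable (fun v => e k v * G v) μ := fun k =>
    hGint.bdd_mul (he_cont k).aestronglyMeasurable (.of_forall fun v => (he_norm k v).le)
  set D := ZSpan.fundamentalDomain B
  have hD : IsAddFundamentalDomain L D μ := ZLattice.isAddFundamentalDomain b μ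
  have hcov : ZLattice.covolume L μ = μ.real D :=
    ZLattice.covolume_eq_measure_fundamentalDomain L μ hD
  have hcov0 := ZLattice.covolume_ne_zero L μ
  set Φ : V → ℂ := fun v => ∑' γ : L, G (v + γ)
  have hΦ : Continuous Φ := ZLattice.continuous_tsum_add L hG hN hC
  have hΦ_add : ∀ (v : V) (γ : L), Φ (v + γ) = Φ v := by
    intro v γ
    simp only [Φ]
    rw [← (Equiv.addLeft γ).tsum_eq fun γ' : L => G (v + γ')]
    simp [add_assoc]
  have hquot : IsOpenQuotientMap (Pi.map fun (_ : ι) (x : ℝ) => (x : UnitAddCircle)) := (IsOpenQuotientMap.piMap fun _ : ι =>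
    (QuotientAddGroup.isOpenQuotientMap_mk (N := AddSubgroup.zmultiples (1 : ℝ))))
  set π : C(ι → ℝ, UnitAddTorus ι) := ⟨_, hquot.continuous⟩ with hπdef
  have hπ : IsQuotientMap π := hquot.isQuotientMap
  let g : C(ι → ℝ, ℂ) := ⟨fun u => Φ (B.equivFun.symm u), hΦ.comp hcont'⟩
  -- Points with the same image in the torus differ by an integer vector, that is, by an element of
  -- `L` in the coordinates of `B`.
  have hg : Function.FactorsThrough g π := by
    intro u w huw
    have h1 : ∀ i, ∃ n : ℤ, u i - w i = n := by
      intro i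
      have := congrFun huw i
      simp only [hπdef, ContinuousMap.coe_mk, Pi.map_apply] at this
      rw [← sub_eq_zero, ← AddCircle.coe_sub, AddCircle.coe_eq_zero_iff] at this
      obtain ⟨n, hn⟩ := this
      exact ⟨n, by simpa using hn.symm⟩
    choose n hn using h1
    have h2 : B.equivFun.symm u = B.equivFun.symm w + (∑ i, n i • b i : L) := by
      rw [← sub_eq_iff_eq_add', ← map_sub, Module.Basis.equivFun_symm_apply]
      simp [Pi.sub_apply, hn, hBdef, Int.cast_smul_eq_zsmul]
    change Φ _ = Φ _
    rw [h2, hΦ_add]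
  let f : C(UnitAddTorus ι, ℂ) := hπ.lift g hg
  have hf : ∀ u, f (π u) = Φ (B.equivFun.symm u) := fun u =>
    DFunLike.congr_fun (hπ.lift_comp g hg) u
  have hcoef : ∀ k, mFourierCoeff f k =
      ((ZLattice.covolume L μ)⁻¹ : ℝ) * ∫ v, e k v * G v ∂μ := by
    intro k
    have h1 : mFourierCoeff f k = ∫ u in {u : ι → ℝ | ∀ i, u i ∈ Set.Ioc (0 : ℝ) (0 + 1)},
        e k (B.equivFun.symm u) * Φ (B.equivFun.symm u) := by
      rw [mFourierCoeff_eq_integral f k 0]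
      refine integral_congr_ae (.of_forall fun u => ?_)
      have h2 := hf u
      simp only [hπdef, ContinuousMap.coe_mk] at h2
      simp only [mFourier_neg_coe, smul_eq_mul]
      rw [← h2]
      simp only [hedef, ← Module.Basis.equivFun_apply, LinearEquiv.apply_symm_apply]
      rfl
    have h2 := ZSpan.setIntegral_fundamentalDomain_comp_equivFun B μ
      fun u => e k (B.equivFun.symm u) * Φ (B.equivFun.symm u)
    rw [← h1, ← hcov] at h2
    simp only [LinearEquiv.symm_apply_apply] at h2
    -- Unfolding: the character is `L`-periodic, so the integral of the periodization over `D` is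
    -- the integral of `e k * G` over the whole space. As `D` is bounded, Peetre's inequality
    -- justifies the interchange.
    have h3 : ∫ v in D, e k v * Φ v ∂μ = ∫ v, e k v * G v ∂μ := by
      have : MeasurableVAdd L V := (inferInstance : MeasurableVAdd L.toAddSubgroup V)
      have : VAddInvariantMeasure L V μ :=
        (inferInstance : VAddInvariantMeasure L.toAddSubgroup V μ)
      rw [hD.integral_eq_tsum'' _ (heG k)]
      simp only [Submodule.vadd_def, vadd_eq_add]
      have h4 : ∀ v, e k v * Φ v = ∑' γ : L, e k (γ + v) * G (γ + v) := by
        intro v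
        simp only [Φ, ← tsum_mul_left, add_comm _ v, he_add]
      simp only [h4]
      refine integral_tsum_of_summable_integral_norm (fun γ => ?_) ?_ |>.symm
      · exact ((heG k).comp_add_left (γ : V)).integrableOn
      · obtain ⟨R, hR⟩ := (ZSpan.fundamentalDomain_isBounded B).exists_norm_le
        have hDfin : μ D < ⊤ := (ZSpan.fundamentalDomain_isBounded B).measure_lt_top
        refine Summable.of_norm_bounded ((((ZLattice.summable_inv_one_add_norm_pow L hN).mul_left
          ((1 + R) ^ N)).mul_left C).mul_right (μ.real D)) fun γ => ?_
        refine norm_setIntegral_le_of_norm_le_const hDfin fun v hv => ?_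
        have hRv := hR v hv
        have hR0 := (norm_nonneg v).trans hRv
        rw [norm_norm, norm_mul, he_norm, one_mul, add_comm]
        refine (hC _).trans ?_
        gcongr
        refine (inv_one_add_norm_add_pow_le N _ _).trans ?_
        gcongr
    rw [← h3, h2, ← mul_assoc, ← Complex.ofReal_mul, inv_mul_cancel₀ hcov0, Complex.ofReal_one,
      one_mul]
  have hsum : Summable (mFourierCoeff f) := by
    simp only [funext hcoef]
    exact hs.mul_left _
  -- Summable coefficients make the Fourier series of the continuous function `f` converge to it at
  -- every point; at `0` all characters equal `1`.
  have := hasSum_mFourier_series_apply_of_summable hsum (π 0)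
  rw [hf] at this
  have h0 : ∀ k : ι → ℤ, mFourier k (π 0) = 1 := by
    intro k
    simp [hπdef, mFourier]
  simp only [h0, smul_eq_mul, mul_one, hcoef, map_zero] at this
  rw [← tsum_mul_left, this.tsum_eq]
  simp [Φ]

end Poisson

/-! ### The dual lattice and its coordinates -/

section DualLattice

variable {E : Type*} [NormedAddCommGroup E] [InnerProductSpace ℝ E]

/-- The inner product of the orthogonal sum of `E` and `ℝ`, as a bilinear form on `E × ℝ`. -/
noncomputable def orthogonalSumForm (E : Type*) [NormedAddCommGroup E] [InnerProductSpace ℝ E] :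
    LinearMap.BilinForm ℝ (E × ℝ) :=
  (innerₗ E).compl₁₂ (LinearMap.fst ℝ E ℝ) (LinearMap.fst ℝ E ℝ) +
    (LinearMap.mul ℝ ℝ).compl₁₂ (LinearMap.snd ℝ E ℝ) (LinearMap.snd ℝ E ℝ)

theorem orthogonalSumForm_apply (v w : E × ℝ) :
    orthogonalSumForm E v w = inner ℝ v.1 w.1 + v.2 * w.2 := by
  simp [orthogonalSumForm]

theorem orthogonalSumForm_nondegenerate : (orthogonalSumForm E).Nondegenerate := by
  constructor
  · intro v hv
    have h := hv v
    rw [orthogonalSumForm_apply, real_inner_self_eq_norm_sq] at h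
    have h1 : ‖v.1‖ = 0 := by nlinarith [sq_nonneg ‖v.1‖, mul_self_nonneg v.2]
    have h2 : v.2 = 0 := by nlinarith [sq_nonneg ‖v.1‖, mul_self_nonneg v.2]
    exact Prod.ext (norm_eq_zero.mp h1) h2
  · intro v hv
    have h := hv v
    rw [orthogonalSumForm_apply, real_inner_self_eq_norm_sq] at h
    have h1 : ‖v.1‖ = 0 := by nlinarith [sq_nonneg ‖v.1‖, mul_self_nonneg v.2]
    have h2 : v.2 = 0 := by nlinarith [sq_nonneg ‖v.1‖, mul_self_nonneg v.2]
    exact Prod.ext (norm_eq_zero.mp h1) h2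

theorem dualLattice_eq_dualSubmodule (Γ : Submodule ℤ (E × ℝ)) :
    dualLattice Γ = (orthogonalSumForm E).dualSubmodule Γ := by
  ext η
  rw [LinearMap.BilinForm.mem_dualSubmodule]
  refine forall₂_congr fun γ _ => ?_
  rw [orthogonalSumForm_apply, Submodule.mem_one, real_inner_comm, mul_comm]
  simp [eq_comm]

variable [FiniteDimensional ℝ E] (Γ : Submodule ℤ (E × ℝ)) [DiscreteTopology Γ] [IsZLattice ℝ Γ]
  {ι : Type*} [Fintype ι]

open Classical in
/-- The basis of `E × ℝ` dual to a `ℤ`-basis of a lattice. -/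
noncomputable def dualLatticeBasis (b : Module.Basis ι ℤ Γ) : Module.Basis ι ℝ (E × ℝ) :=
  (orthogonalSumForm E).dualBasis orthogonalSumForm_nondegenerate (b.ofZLatticeBasis ℝ Γ)

variable {Γ} in
theorem orthogonalSumForm_dualLatticeBasis (b : Module.Basis ι ℤ Γ) (i : ι) (v : E × ℝ) :
    orthogonalSumForm E (dualLatticeBasis Γ b i) v = (b.ofZLatticeBasis ℝ Γ).repr v i := by
  classical
  conv_lhs => rw [← (b.ofZLatticeBasis ℝ Γ).sum_repr v]
  simp [dualLatticeBasis, LinearMap.BilinForm.apply_dualBasis_left, -Module.Basis.sum_repr,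
    -Module.Basis.ofZLatticeBasis_apply]

variable {Γ} in
theorem dualLattice_eq_span (b : Module.Basis ι ℤ Γ) :
    dualLattice Γ = Submodule.span ℤ (Set.range (dualLatticeBasis Γ b)) := by
  classical
  rw [dualLattice_eq_dualSubmodule]
  conv_lhs => rw [← b.ofZLatticeBasis_span ℝ]
  exact LinearMap.BilinForm.dualSubmodule_span_of_basis _ orthogonalSumForm_nondegenerate _

instance dualLattice.instDiscreteTopology : DiscreteTopology (dualLattice Γ) := by
  rw [dualLattice_eq_span (Module.Free.chooseBasis ℤ Γ)]
  infer_instance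

instance dualLattice.instIsZLattice : IsZLattice ℝ (dualLattice Γ) := by
  constructor
  rw [dualLattice_eq_span (Module.Free.chooseBasis ℤ Γ)]
  exact IsZLattice.span_top

variable {Γ} in
/-- Coordinates on the dual lattice with respect to a `ℤ`-basis of the lattice. -/
noncomputable def dualLatticeEquiv (b : Module.Basis ι ℤ Γ) : (ι → ℤ) ≃ dualLattice Γ :=
  (((dualLatticeBasis Γ b).restrictScalars ℤ).equivFun.symm.trans
    (LinearEquiv.ofEq _ _ (dualLattice_eq_span b).symm)).toEquiv

/-- Translates the phase of the coordinate form of Poisson summation into the pairing with a dual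
lattice point. -/
theorem sum_mul_repr_eq_inner_dualLatticeEquiv (b : Module.Basis ι ℤ Γ) (k : ι → ℤ) (v : E × ℝ) :
    ∑ i, k i * (b.ofZLatticeBasis ℝ Γ).repr v i =
      inner ℝ v.1 (dualLatticeEquiv b k : E × ℝ).1 + v.2 * (dualLatticeEquiv b k : E × ℝ).2 := by
  have h : (dualLatticeEquiv b k : E × ℝ) = ∑ i, (k i : ℝ) • dualLatticeBasis Γ b i := by
    simp [dualLatticeEquiv, Module.Basis.equivFun_symm_apply, Int.cast_smul_eq_zsmul]
  rw [real_inner_comm, mul_comm, ← orthogonalSumForm_apply, h]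
  simp [orthogonalSumForm_dualLatticeBasis]

end DualLattice

/-! ### Poisson summation for products of Schwartz functions -/

section SchwartzPoisson

theorem SchwartzMap.exists_norm_le_inv_one_add_norm_pow {E F : Type*} [NormedAddCommGroup E]
    [NormedSpace ℝ E] [NormedAddCommGroup F] [NormedSpace ℝ F] (f : 𝓢(E, F)) (N : ℕ) :
    ∃ C : ℝ, 0 ≤ C ∧ ∀ x, ‖f x‖ ≤ C * ((1 + ‖x‖) ^ N)⁻¹ := by
  refine ⟨2 ^ N * (Finset.Iic (N, 0)).sup (fun m => SchwartzMap.seminorm ℝ m.1 m.2) f,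
    by positivity, fun x => ?_⟩
  rw [← div_eq_mul_inv, le_div_iff₀ (by positivity), mul_comm]
  simpa using SchwartzMap.one_add_le_sup_seminorm_apply (𝕜 := ℝ) (m := (N, 0)) le_rfl le_rfl f x

/-- The product carries the maximum norm, and `1 + max a b ≤ (1 + a)(1 + b)` for `a, b ≥ 0`. -/
theorem SchwartzMap.exists_norm_mul_le_inv_one_add_norm_pow {E : Type*} [NormedAddCommGroup E]
    [NormedSpace ℝ E] (f : 𝓢(E, ℂ)) (h : 𝓢(ℝ, ℂ)) (N : ℕ) :
    ∃ C : ℝ, 0 ≤ C ∧ ∀ v : E × ℝ, ‖f v.1 * h v.2‖ ≤ C * ((1 + ‖v‖) ^ N)⁻¹ := by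
  obtain ⟨C₁, hC₁, hf⟩ := f.exists_norm_le_inv_one_add_norm_pow N
  obtain ⟨C₂, hC₂, hh⟩ := h.exists_norm_le_inv_one_add_norm_pow N
  refine ⟨C₁ * C₂, by positivity, fun v => ?_⟩
  have hv : ((1 + ‖v.1‖) ^ N)⁻¹ * ((1 + ‖v.2‖) ^ N)⁻¹ ≤ ((1 + ‖v‖) ^ N)⁻¹ := by
    rw [← mul_inv, ← mul_pow]
    gcongr
    rw [Prod.norm_def]
    rcases max_cases ‖v.1‖ ‖v.2‖ with h | h <;> rw [h.1] <;>
      nlinarith [norm_nonneg v.1, norm_nonneg v.2, mul_nonneg (norm_nonneg v.1) (norm_nonneg v.2)]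
  calc ‖f v.1 * h v.2‖ = ‖f v.1‖ * ‖h v.2‖ := norm_mul _ _
    _ ≤ (C₁ * ((1 + ‖v.1‖) ^ N)⁻¹) * (C₂ * ((1 + ‖v.2‖) ^ N)⁻¹) := by
        gcongr
        · exact hf _
        · exact hh _
    _ = C₁ * C₂ * (((1 + ‖v.1‖) ^ N)⁻¹ * ((1 + ‖v.2‖) ^ N)⁻¹) := by ring
    _ ≤ _ := by gcongr

variable {E : Type*} [NormedAddCommGroup E] [InnerProductSpace ℝ E]

theorem norm_modChar (ξ t : E) : ‖modChar ξ t‖ = 1 := by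
  have : 2 * Real.pi * Complex.I * ((inner ℝ ξ t : ℝ) : ℂ) =
      ((2 * Real.pi * inner ℝ ξ t : ℝ) : ℂ) * Complex.I := by push_cast; ring
  rw [modChar, this, Complex.norm_exp_ofReal_mul_I]

theorem modChar_mul_modChar (ξ ξ' t : E) : modChar ξ t * modChar ξ' t = modChar (ξ + ξ') t := by
  rw [modChar, modChar, modChar, ← Complex.exp_add, inner_add_left]
  push_cast
  ring_nf

theorem modChar_add (ξ s t : E) : modChar ξ (s + t) = modChar ξ s * modChar ξ t := by
  rw [modChar, modChar, modChar, ← Complex.exp_add, inner_add_right]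
  push_cast
  ring_nf

theorem continuous_modChar : Continuous fun p : E × E => modChar p.1 p.2 := by
  unfold modChar
  fun_prop

variable [FiniteDimensional ℝ E] [MeasurableSpace E] [BorelSpace E]

theorem fourier_eq_integral_modChar (f : E → ℂ) (ξ : E) :
    𝓕 f ξ = ∫ t, modChar (-ξ) t * f t := by
  rw [Real.fourier_eq']
  refine integral_congr_ae (.of_forall fun t => ?_)
  simp only [modChar, smul_eq_mul, inner_neg_left, real_inner_comm]
  congr 2
  push_cast
  ring

/-- The Fourier transform of a time-frequency shift. -/
theorem fourier_tfShift (x ξ : E) (g : 𝓢(E, ℂ)) (y : E) :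
    𝓕 (tfShift x ξ g : E → ℂ) y = modChar (ξ - y) x * 𝓕 (g : E → ℂ) (y - ξ) := by
  rw [fourier_eq_integral_modChar, fourier_eq_integral_modChar, ← integral_const_mul,
    ← integral_add_right_eq_self _ x]
  refine integral_congr_ae (.of_forall fun t => ?_)
  simp only [tfShift_apply, add_sub_cancel_right]
  rw [← mul_assoc, modChar_mul_modChar, modChar_add, neg_sub, neg_add_eq_sub]
  ring

theorem integral_exp_repr_mul_schwartz_mul_schwartz {Γ : Submodule ℤ (E × ℝ)} [DiscreteTopology Γ]
    [IsZLattice ℝ Γ] {ι : Type*} [Fintype ι] (b : Module.Basis ι ℤ Γ) (f : 𝓢(E, ℂ)) (h : 𝓢(ℝ, ℂ))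
    (k : ι → ℤ) :
    ∫ v : E × ℝ, Complex.exp (-(2 * Real.pi * Complex.I *
      ((∑ i, k i * (b.ofZLatticeBasis ℝ Γ).repr v i : ℝ) : ℂ))) * (f v.1 * h v.2) =
      𝓕 (f : E → ℂ) (dualLatticeEquiv b k : E × ℝ).1 *
        𝓕 (h : ℝ → ℂ) (dualLatticeEquiv b k : E × ℝ).2 := by
  rw [fourier_eq_integral_modChar, fourier_eq_integral_modChar, ← integral_prod_mul,
    ← Measure.volume_eq_prod]
  refine integral_congr_ae (.of_forall fun v => ?_)
  simp only [sum_mul_repr_eq_inner_dualLatticeEquiv, modChar]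
  generalize (dualLatticeEquiv b k : E × ℝ) = η
  rw [mul_mul_mul_comm, ← Complex.exp_add]
  congr 2
  have : inner ℝ η.2 v.2 = v.2 * η.2 := by simp
  rw [inner_neg_left, real_inner_comm, inner_neg_left, this]
  push_cast
  ring

/-- **Poisson summation** over a lattice in `E × ℝ` for a tensor product of Schwartz functions. -/
theorem ZLattice.tsum_schwartz_mul_schwartz (Γ : Submodule ℤ (E × ℝ)) [DiscreteTopology Γ]
    [IsZLattice ℝ Γ] (f : 𝓢(E, ℂ)) (h : 𝓢(ℝ, ℂ)) :
    ∑' γ : Γ, f (γ : E × ℝ).1 * h (γ : E × ℝ).2 =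
      ((ZLattice.covolume Γ volume)⁻¹ : ℝ) * ∑' η : dualLattice Γ,
        𝓕 (f : E → ℂ) (η : E × ℝ).1 * 𝓕 (h : ℝ → ℂ) (η : E × ℝ).2 := by
  have : (volume : Measure (E × ℝ)).IsAddHaarMeasure := by
    rw [Measure.volume_eq_prod]; infer_instance
  obtain ⟨b⟩ : Nonempty (Module.Basis (Module.Free.ChooseBasisIndex ℤ Γ) ℤ Γ) :=
    ⟨Module.Free.chooseBasis ℤ Γ⟩
  obtain ⟨N, hN⟩ := exists_gt (Module.finrank ℝ (E × ℝ))
  obtain ⟨C, -, hC⟩ := f.exists_norm_mul_le_inv_one_add_norm_pow h N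
  obtain ⟨C', -, hC'⟩ := (𝓕 f).exists_norm_mul_le_inv_one_add_norm_pow (𝓕 h) N
  set S : dualLattice Γ → ℂ := fun η =>
      𝓕 (f : E → ℂ) (η : E × ℝ).1 * 𝓕 (h : ℝ → ℂ) (η : E × ℝ).2
  have hs : Summable S :=
    .of_norm_bounded ((ZLattice.summable_inv_one_add_norm_pow (dualLattice Γ) hN).mul_left C')
      fun η => hC' η
  have hint : ∀ k, ∫ v : E × ℝ, Complex.exp (-(2 * Real.pi * Complex.I *
      ((∑ i, k i * (b.ofZLatticeBasis ℝ Γ).repr v i : ℝ) : ℂ))) * (f v.1 * h v.2) =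
      (S ∘ dualLatticeEquiv b) k := integral_exp_repr_mul_schwartz_mul_schwartz b f h
  have hpoisson := ZLattice.tsum_eq_tsum_integral Γ b volume (G := fun v => f v.1 * h v.2)
    (by fun_prop) hN hC
  simp only [hint] at hpoisson
  rw [hpoisson ((dualLatticeEquiv b).summable_iff.mpr hs), ← (dualLatticeEquiv b).tsum_eq S]
  rfl

end SchwartzPoisson

/-! ### Feichtinger's algebra as integrable superpositions of atoms -/

section AtomicDecomposition

variable {E : Type*} [NormedAddCommGroup E] [InnerProductSpace ℝ E]

theorem continuous_tfShift (g : 𝓢(E, ℂ)) :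
    Continuous fun q : (E × E) × E => tfShift q.1.1 q.1.2 g q.2 := by
  simp only [tfShift_apply]
  have := continuous_modChar (E := E)
  have h : Continuous fun q : (E × E) × E => modChar q.1.2 q.2 :=
    this.comp (by fun_prop : Continuous fun q : (E × E) × E => (q.1.2, q.2))
  fun_prop

variable [FiniteDimensional ℝ E] [MeasurableSpace E] [BorelSpace E]

theorem continuous_fourier_tfShift (g : 𝓢(E, ℂ)) :
    Continuous fun q : (E × E) × E => 𝓕 (tfShift q.1.1 q.1.2 g : E → ℂ) q.2 := by
  simp only [fourier_tfShift]
  have := continuous_modChar (E := E)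
  have h : Continuous fun q : (E × E) × E => modChar (q.1.2 - q.2) q.1.1 :=
    this.comp (by fun_prop : Continuous fun q : (E × E) × E => (q.1.2 - q.2, q.1.1))
  have h2 : Continuous (𝓕 (g : E → ℂ)) := (𝓕 g).continuous
  fun_prop

/-- The short-time Fourier transform of a function is a Fourier transform of a windowed function. -/
theorem stft_eq_fourier (g : 𝓢(E, ℂ)) {T : 𝓢'(E, ℂ)} {F : E → ℂ}
    (hT : ∀ φ : 𝓢(E, ℂ), T φ = ∫ t, F t * φ t) (x ξ : E) :
    stft g T (x, ξ) = 𝓕 (fun t => F t * (starRingEnd ℂ) (g (t - x))) ξ := by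
  rw [stft, hT, fourier_eq_integral_modChar]
  refine integral_congr_ae (.of_forall fun t => ?_)
  have : (starRingEnd ℂ) (modChar ξ t) = modChar (-ξ) t := by
    rw [modChar, modChar, ← Complex.exp_conj]
    congr 1
    simp [map_ofNat (starRingEnd ℂ) 2]
  simp only [conjSchwartz_apply, tfShift_apply, map_mul, this]
  ring

theorem SchwartzMap.integral_norm_sq_pos {g : 𝓢(E, ℂ)} (hg : g ≠ 0) : 0 < ∫ t, ‖g t‖ ^ 2 := by
  have hint : Integrable fun t => ‖g t‖ ^ 2 := (g.memLp 2).integrable_norm_pow (by norm_num)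
  refine lt_of_le_of_ne (integral_nonneg fun _ => by positivity) fun h => hg ?_
  have h0 := (integral_eq_zero_iff_of_nonneg (fun _ => by positivity) hint).mp h.symm
  have h1 := (Continuous.ae_eq_iff_eq volume (by fun_prop) continuous_const).mp h0
  ext t
  exact norm_eq_zero.mp (pow_eq_zero_iff two_ne_zero |>.mp (congrFun h1 t))

/-- A function in Feichtinger's algebra is an integrable superposition of time-frequency shifts of
a Schwartz function. -/
theorem MemM1.exists_eq_integral_tfShift {F : E → ℂ} (hF : MemM1 F) :
    ∃ (g : 𝓢(E, ℂ)) (V : E × E → ℂ), Integrable V ∧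
      ∀ t, F t = ∫ p : E × E, V p * tfShift p.1 p.2 g t := by
  obtain ⟨hFc, T, ⟨g, hg, hV⟩, hT⟩ := hF
  set c : ℝ := ∫ t, ‖g t‖ ^ 2
  have hc : 0 < c := SchwartzMap.integral_norm_sq_pos hg
  refine ⟨g, fun p => (c : ℂ)⁻¹ * stft g T p, hV.const_mul _, fun t => ?_⟩
  obtain ⟨Cg, -, hCg⟩ := g.exists_norm_le_inv_one_add_norm_pow 0
  have hint : Integrable fun p : E × E => stft g T p * tfShift p.1 p.2 g t := by
    refine hV.mul_bdd (c := Cg) ?_ (.of_forall fun p => ?_)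
    · exact ((continuous_tfShift g).comp
        (by fun_prop : Continuous fun p : E × E => (p, t))).aestronglyMeasurable
    · simpa [tfShift_apply, norm_modChar] using hCg (t - p.1)
  have hV' : Integrable (stft g T) ((volume : Measure E).prod volume) := hV
  -- For almost every `x` the slice `ξ ↦ V_g F(x, ξ)` is an integrable Fourier transform of a
  -- continuous integrable function. Fourier inversion then holds at every point, in particular at
  -- the given `t`.
  have hslice : ∀ᵐ x : E, ∫ ξ, stft g T (x, ξ) * tfShift x ξ g t = F t * (‖g (t - x)‖ ^ 2 : ℝ) := by
    filter_upwards [hV'.prod_right_ae] with x hx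
    set h : E → ℂ := fun t => F t * (starRingEnd ℂ) (g (t - x))
    have hh : Continuous h := by
      have := Complex.continuous_conj
      fun_prop
    have hhi : Integrable h :=
      (hT (conjSchwartz (SchwartzMap.compSubConstCLM ℂ x g))).1
    have hst : ∀ ξ, stft g T (x, ξ) = 𝓕 h ξ := stft_eq_fourier g (fun φ => (hT φ).2) x
    simp only [hst] at hx ⊢
    have hinv := congrFun (hh.fourierInv_fourier_eq hhi hx) t
    rw [Real.fourierInv_eq'] at hinv
    have : ∀ ξ, 𝓕 h ξ * tfShift x ξ g t = Complex.exp (↑(2 * Real.pi * inner ℝ ξ t) * Complex.I) •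
        𝓕 h ξ * g (t - x) := by
      intro ξ
      rw [tfShift_apply, modChar, smul_eq_mul]
      push_cast
      ring_nf
    simp only [this]
    rw [integral_mul_const, hinv]
    simp only [h]
    rw [mul_assoc, mul_comm ((starRingEnd ℂ) _), Complex.mul_conj']
    push_cast
    rfl
  -- Integrating the slices over `x` turns `‖g (t - x)‖ ^ 2` into the constant `c`.
  have : ∫ p : E × E, stft g T p * tfShift p.1 p.2 g t = F t * c := by
    rw [Measure.volume_eq_prod, integral_prod _ hint, integral_congr_ae hslice, integral_const_mul,
      integral_complex_ofReal, integral_sub_left_eq_self (fun y => ‖g y‖ ^ 2) volume t]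
  simp only [mul_assoc]
  rw [integral_const_mul, this, mul_comm (F t), inv_mul_cancel_left₀ (by exact_mod_cast hc.ne')]

variable {g : 𝓢(E, ℂ)} {V : E × E → ℂ} {F : E → ℂ}

/-- The translation `x` contributes only a phase, which is why the dual estimates are uniform in
`x`. -/
theorem norm_fourier_tfShift (x ξ y : E) :
    ‖𝓕 (tfShift x ξ g : E → ℂ) y‖ = ‖𝓕 g (y - ξ)‖ := by
  rw [fourier_tfShift, norm_mul, norm_modChar, one_mul, SchwartzMap.fourier_coe]

/-- By Tonelli, since every atom has the same `L¹` norm as `g`. This yields both the integrability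
of `F` and the Fubini step for its Fourier transform. -/
theorem integrable_mul_tfShift (g : 𝓢(E, ℂ)) (hV : Integrable V) :
    Integrable (fun q : (E × E) × E => V q.1 * tfShift q.1.1 q.1.2 g q.2)
      ((volume : Measure (E × E)).prod volume) := by
  have hm : AEStronglyMeasurable (fun q : (E × E) × E => V q.1 * tfShift q.1.1 q.1.2 g q.2)
      ((volume : Measure (E × E)).prod volume) :=
    hV.aestronglyMeasurable.comp_fst.mul (continuous_tfShift g).aestronglyMeasurable
  rw [integrable_prod_iff hm]
  refine ⟨.of_forall fun p => ((tfShift p.1 p.2 g).integrable (μ := volume)).const_mul (V p), ?_⟩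
  have : ∀ p : E × E, ∫ t, ‖V p * tfShift p.1 p.2 g t‖ = ‖V p‖ * ∫ t, ‖g t‖ := by
    intro p
    simp only [norm_mul, tfShift_apply, norm_modChar, one_mul]
    rw [integral_const_mul, integral_sub_right_eq_self (fun y => ‖g y‖)]
  simp only [this]
  exact hV.norm.mul_const _

theorem integrable_of_eq_integral_tfShift (hV : Integrable V)
    (hF : ∀ t, F t = ∫ p : E × E, V p * tfShift p.1 p.2 g t) : Integrable F := by
  rw [funext hF]
  exact (integrable_mul_tfShift g hV).integral_prod_right

theorem fourier_eq_integral_fourier_tfShift (hV : Integrable V)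
    (hF : ∀ t, F t = ∫ p : E × E, V p * tfShift p.1 p.2 g t) (y : E) :
    𝓕 F y = ∫ p : E × E, V p * 𝓕 (tfShift p.1 p.2 g : E → ℂ) y := by
  have h1 : Integrable (fun q : (E × E) × E =>
      modChar (-y) q.2 * (V q.1 * tfShift q.1.1 q.1.2 g q.2))
      ((volume : Measure (E × E)).prod volume) := by
    refine (integrable_mul_tfShift g hV).bdd_mul (c := 1) ?_
      (.of_forall fun q => (norm_modChar _ _).le)
    exact (continuous_modChar.comp
      (by fun_prop : Continuous fun q : (E × E) × E => (-y, q.2))).aestronglyMeasurable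
  rw [fourier_eq_integral_modChar]
  simp only [hF, fourier_eq_integral_modChar, ← integral_const_mul]
  rw [← integral_integral_swap (f := fun p t => modChar (-y) t * (V p * tfShift p.1 p.2 g t)) h1]
  refine integral_congr_ae (.of_forall fun p => ?_)
  refine integral_congr_ae (.of_forall fun t => ?_)
  simp only
  ring

end AtomicDecomposition

/-! ### Interchange of sums with superposition integrals -/

section Superposition

/-- Integrating a family of kernels against a function yields a summable family when the kernels
are pointwise summable with an integrable bound. -/
theorem summable_integral_norm_mul_of_tsum_le {α ι : Type*} [MeasurableSpace α] {μ : Measure α}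
    {V : α → ℂ} {K : ι → α → ℂ} {B : α → ℝ} (hV : AEStronglyMeasurable V μ)
    (hK : ∀ i, AEStronglyMeasurable (K i) μ) (hVB : Integrable (fun p => ‖V p‖ * B p) μ)
    (hs : ∀ p, Summable fun i => ‖K i p‖) (hB : ∀ p, ∑' i, ‖K i p‖ ≤ B p) :
    (∀ i, Integrable (fun p => V p * K i p) μ) ∧
      Summable (fun i => ∫ p, ‖V p * K i p‖ ∂μ) ∧
      ∑' i, ∫ p, ‖V p * K i p‖ ∂μ ≤ ∫ p, ‖V p‖ * B p ∂μ := by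
  -- Bounds for finite partial sums suffice, so no infinite sum has to be integrated.
  have hle : ∀ (s : Finset ι) p, ∑ i ∈ s, ‖V p * K i p‖ ≤ ‖V p‖ * B p := by
    intro s p
    simp only [norm_mul, ← Finset.mul_sum]
    gcongr
    exact ((hs p).sum_le_tsum s fun _ _ => norm_nonneg _).trans (hB p)
  have hint : ∀ i, Integrable (fun p => V p * K i p) μ := fun i =>
    hVB.mono' (hV.mul (hK i)) (.of_forall fun p => by simpa using hle {i} p)
  have hsum : ∀ s : Finset ι, ∑ i ∈ s, ∫ p, ‖V p * K i p‖ ∂μ ≤ ∫ p, ‖V p‖ * B p ∂μ := by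
    intro s
    rw [← integral_finsetSum _ fun i _ => (hint i).norm]
    exact integral_mono (integrable_finsetSum _ fun i _ => (hint i).norm) hVB (hle s)
  have hs' := summable_of_sum_le (fun i => integral_nonneg fun p => norm_nonneg _) hsum
  exact ⟨hint, hs', hs'.tsum_le_of_sum_le hsum⟩

end Superposition

/-! ### Lattice sums of atoms and of their Fourier transforms -/

section LatticeKernels

/-- One of the `N + 1` powers is spent on the lower bound `m` for the distance; the other `N` keep
the lattice sum convergent. -/
theorem mul_inv_one_add_pow_succ_le (N : ℕ) {A m D : ℝ} (hA : 0 ≤ A) (hm : 0 ≤ m) (hD : m ≤ D) :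
    A * ((1 + D) ^ (N + 1))⁻¹ ≤ A * (1 + m)⁻¹ * ((1 + D) ^ N)⁻¹ := by
  have : 0 ≤ D := hm.trans hD
  rw [pow_succ', mul_inv, mul_assoc]
  gcongr

variable {E : Type*} [NormedAddCommGroup E] [InnerProductSpace ℝ E] [FiniteDimensional ℝ E]

/-- Modulation does not change moduli, and translation only recentres the majorant at `(x, 0)`, so
one constant serves all atoms. -/
theorem ZLattice.exists_tsum_norm_tfShift_mul_le (Γ : Submodule ℤ (E × ℝ)) [DiscreteTopology Γ]
    [IsZLattice ℝ Γ] (g : 𝓢(E, ℂ)) (h : 𝓢(ℝ, ℂ)) :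
    ∃ C : ℝ, ∀ x ξ : E,
      Summable (fun γ : Γ => ‖tfShift x ξ g (γ : E × ℝ).1 * h (γ : E × ℝ).2‖) ∧
      ∑' γ : Γ, ‖tfShift x ξ g (γ : E × ℝ).1 * h (γ : E × ℝ).2‖ ≤ C := by
  obtain ⟨N, hN⟩ := exists_gt (Module.finrank ℝ (E × ℝ))
  obtain ⟨A, hA, hgh⟩ := g.exists_norm_mul_le_inv_one_add_norm_pow h N
  obtain ⟨C, -, hC⟩ := ZLattice.exists_summable_tsum_inv_one_add_norm_sub_le Γ hN
  refine ⟨A * C, fun x ξ => ?_⟩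
  have hle : ∀ γ : Γ, ‖tfShift x ξ g (γ : E × ℝ).1 * h (γ : E × ℝ).2‖ ≤
      A * ((1 + ‖(γ : E × ℝ) - (x, 0)‖) ^ N)⁻¹ := by
    intro γ
    have := hgh ((γ : E × ℝ) - (x, 0))
    simpa [tfShift_apply, norm_modChar] using this
  obtain ⟨h1, h2⟩ := hC (x, 0)
  have hs := Summable.of_nonneg_of_le (fun γ => norm_nonneg _) hle (h1.mul_left A)
  refine ⟨hs, (hs.tsum_le_tsum hle (h1.mul_left A)).trans ?_⟩
  rw [tsum_mul_left]
  gcongr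

variable [MeasurableSpace E] [BorelSpace E]

/-- Sums over a lattice of the Fourier transforms of time-frequency shifts, restricted to the
complement of a ball about `(z, 0)`, decay uniformly in `z`. -/
theorem ZLattice.exists_tsum_norm_fourier_tfShift_mul_le (L : Submodule ℤ (E × ℝ))
    [DiscreteTopology L] [IsZLattice ℝ L] (g : 𝓢(E, ℂ)) (h : 𝓢(ℝ, ℂ)) :
    ∃ C : ℝ, 0 ≤ C ∧ ∀ (x ξ z : E) (R : ℝ) (S : Set L),
      (∀ η ∈ S, R ≤ dist (η : E × ℝ) (z, 0)) →
      Summable (fun η : S => ‖𝓕 (tfShift x ξ g : E → ℂ) (z - (η : E × ℝ).1) *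
        h (-(η : E × ℝ).2)‖) ∧
      ∑' η : S, ‖𝓕 (tfShift x ξ g : E → ℂ) (z - (η : E × ℝ).1) * h (-(η : E × ℝ).2)‖ ≤
        C * (1 + max 0 (R - ‖ξ‖))⁻¹ := by
  obtain ⟨N, hN⟩ := exists_gt (Module.finrank ℝ (E × ℝ))
  obtain ⟨A, hA, hgh⟩ := (𝓕 g).exists_norm_mul_le_inv_one_add_norm_pow h (N + 1)
  obtain ⟨C, hC0, hC⟩ := ZLattice.exists_summable_tsum_inv_one_add_norm_sub_le L hN
  refine ⟨A * C, by positivity, fun x ξ z R S hS => ?_⟩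
  obtain ⟨h1, h2⟩ := hC (z - ξ, 0)
  have hle : ∀ η : S, ‖𝓕 (tfShift x ξ g : E → ℂ) (z - (η : E × ℝ).1) * h (-(η : E × ℝ).2)‖ ≤
      A * (1 + max 0 (R - ‖ξ‖))⁻¹ * ((1 + ‖(η : E × ℝ) - (z - ξ, 0)‖) ^ N)⁻¹ := by
    intro η
    have h3 := hgh ((z - ξ, 0) - (η : E × ℝ))
    rw [norm_sub_rev] at h3
    -- The summand is concentrated about `(z - ξ, 0)`, at distance `‖ξ‖` from the centre `(z, 0)` of
    -- truncation.
    have h4 : R ≤ ‖(η : E × ℝ) - (z - ξ, 0)‖ + ‖ξ‖ := by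
      have h5 : (η : E × ℝ) - (z, 0) = ((η : E × ℝ) - (z - ξ, 0)) - (ξ, 0) := by
        ext
        · simp only [Prod.fst_sub]; abel
        · simp
      have h6 : ‖((ξ, 0) : E × ℝ)‖ = ‖ξ‖ := by simp [Prod.norm_def]
      have h7 := hS η η.2
      rw [dist_eq_norm, h5] at h7
      have h8 := norm_sub_le ((η : E × ℝ) - (z - ξ, 0)) ((ξ, 0) : E × ℝ)
      rw [h6] at h8
      exact h7.trans h8
    have h10 := mul_inv_one_add_pow_succ_le N hA (le_max_left 0 (R - ‖ξ‖))
      (max_le (norm_nonneg _) (sub_le_iff_le_add.mpr h4))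
    refine le_trans (le_of_eq ?_) (h3.trans h10)
    rw [norm_mul, norm_mul, norm_fourier_tfShift]
    simp [sub_right_comm]
  have hsub : Summable fun η : S => ((1 + ‖(η : E × ℝ) - (z - ξ, 0)‖) ^ N)⁻¹ := h1.subtype S
  have hs := Summable.of_nonneg_of_le (fun η => norm_nonneg _) hle (hsub.mul_left (A * (1 + max 0 (R - ‖ξ‖))⁻¹))
  refine ⟨hs, (hs.tsum_le_tsum hle (hsub.mul_left (A * (1 + max 0 (R - ‖ξ‖))⁻¹))).trans ?_⟩
  rw [tsum_mul_left]
  have h9 : ∑' η : S, ((1 + ‖(η : E × ℝ) - (z - ξ, 0)‖) ^ N)⁻¹ ≤ C :=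
    (h1.tsum_subtype_le _ S (fun η => by positivity)).trans h2
  calc
    _ ≤ A * (1 + max 0 (R - ‖ξ‖))⁻¹ * C := by gcongr
    _ = _ := mul_right_comm _ _ _

end LatticeKernels

/-! ### Poisson summation and tail estimates for superpositions -/

section PoissonSuperposition

variable {E : Type*} [NormedAddCommGroup E] [InnerProductSpace ℝ E] [FiniteDimensional ℝ E]
  [MeasurableSpace E] [BorelSpace E]

omit [FiniteDimensional ℝ E] [MeasurableSpace E] [BorelSpace E] in
theorem modChar_mul_tfShift (x ξ z t : E) (g : 𝓢(E, ℂ)) :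
    modChar (-z) t * tfShift x ξ g t = tfShift x (ξ - z) g t := by
  rw [tfShift_apply, tfShift_apply, ← mul_assoc, modChar_mul_modChar, neg_add_eq_sub]

/-- The character in the left series lowers the frequency of an atom by `z`; after the reflection `η
↦ -η` of the dual lattice this becomes evaluation at `z - η`. -/
theorem fourier_tfShift_sub (x ξ z η : E) (g : 𝓢(E, ℂ)) :
    𝓕 (tfShift x (ξ - z) g : E → ℂ) (-η) = 𝓕 (tfShift x ξ g : E → ℂ) (z - η) := by
  have h1 : ξ - z - -η = ξ - (z - η) := by abel
  have h2 : -η - (ξ - z) = z - η - ξ := by abel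
  rw [fourier_tfShift, fourier_tfShift, h1, h2]

/-- Poisson summation for a time-frequency shift tensored with a Schwartz function on `ℝ`. -/
theorem ZLattice.tsum_tfShift_mul (Γ : Submodule ℤ (E × ℝ)) [DiscreteTopology Γ]
    [IsZLattice ℝ Γ] (g : 𝓢(E, ℂ)) (h : 𝓢(ℝ, ℂ)) (x ξ z : E) :
    ∑' γ : Γ, tfShift x (ξ - z) g (γ : E × ℝ).1 * h (γ : E × ℝ).2 =
      ((ZLattice.covolume Γ volume)⁻¹ : ℝ) * ∑' η : dualLattice Γ,
        𝓕 (tfShift x ξ g : E → ℂ) (z - (η : E × ℝ).1) * 𝓕 (h : ℝ → ℂ) (-(η : E × ℝ).2) := by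
  rw [ZLattice.tsum_schwartz_mul_schwartz, ← (Equiv.neg (dualLattice Γ)).tsum_eq]
  congr 1
  refine tsum_congr fun η => ?_
  rw [← fourier_tfShift_sub]
  rfl

variable {g : 𝓢(E, ℂ)} {V : E × E → ℂ} {F : E → ℂ}

/-- The character is absorbed into the atoms, whose lattice sums are dominated by a constant. The
value is kept as an integral over the atoms so that Poisson summation can be applied under the
integral sign. -/
theorem hasSum_modChar_mul_of_eq_integral_tfShift (Γ : Submodule ℤ (E × ℝ)) [DiscreteTopology Γ]
    [IsZLattice ℝ Γ] (h : 𝓢(ℝ, ℂ)) (hV : Integrable V)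
    (hF : ∀ t, F t = ∫ p : E × E, V p * tfShift p.1 p.2 g t) (z : E) :
    Summable (fun γ : Γ => ‖modChar (-z) (γ : E × ℝ).1 * (F (γ : E × ℝ).1 * h (γ : E × ℝ).2)‖) ∧
    HasSum (fun γ : Γ => modChar (-z) (γ : E × ℝ).1 * (F (γ : E × ℝ).1 * h (γ : E × ℝ).2))
      (∫ p : E × E, V p * ∑' γ : Γ, tfShift p.1 (p.2 - z) g (γ : E × ℝ).1 * h (γ : E × ℝ).2) := by
  obtain ⟨C, hC⟩ := ZLattice.exists_tsum_norm_tfShift_mul_le Γ g h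
  obtain ⟨hint, hs, -⟩ := summable_integral_norm_mul_of_tsum_le (μ := volume) (V := V)
    (K := fun (γ : Γ) (p : E × E) => tfShift p.1 (p.2 - z) g (γ : E × ℝ).1 * h (γ : E × ℝ).2)
    (B := fun _ => C) hV.aestronglyMeasurable
    (fun γ => ((continuous_tfShift g).comp (by fun_prop : Continuous fun p : E × E =>
      ((p.1, p.2 - z), (γ : E × ℝ).1))).mul_const _ |>.aestronglyMeasurable)
    (hV.norm.mul_const C) (fun p => (hC p.1 (p.2 - z)).1) (fun p => (hC p.1 (p.2 - z)).2)
  have heq : ∀ γ : Γ, modChar (-z) (γ : E × ℝ).1 * (F (γ : E × ℝ).1 * h (γ : E × ℝ).2) =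
      ∫ p : E × E, V p * (tfShift p.1 (p.2 - z) g (γ : E × ℝ).1 * h (γ : E × ℝ).2) := by
    intro γ
    rw [hF, ← integral_mul_const, ← integral_const_mul]
    refine integral_congr_ae (.of_forall fun p => ?_)
    simp only [← modChar_mul_tfShift]
    ring
  simp only [heq, ← tsum_mul_left]
  exact ⟨hs.of_nonneg_of_le (fun _ => norm_nonneg _) fun _ => norm_integral_le_integral_norm _,
    hasSum_integral_of_summable_integral_norm hint hs⟩

/-- The tails of the dual series are dominated, uniformly in `z`, by an integral over phase space
that tends to zero with the radius of truncation. -/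
theorem exists_hasSum_fourier_mul_of_eq_integral_tfShift (L : Submodule ℤ (E × ℝ))
    [DiscreteTopology L] [IsZLattice ℝ L] (h : 𝓢(ℝ, ℂ)) (hV : Integrable V)
    (hF : ∀ t, F t = ∫ p : E × E, V p * tfShift p.1 p.2 g t) :
    ∃ C : ℝ, ∀ (z : E) (R : ℝ) (S : Set L), (∀ η ∈ S, R ≤ dist (η : E × ℝ) (z, 0)) →
      Summable (fun η : S => ‖𝓕 F (z - (η : E × ℝ).1) * h (-(η : E × ℝ).2)‖) ∧
      ∑' η : S, ‖𝓕 F (z - (η : E × ℝ).1) * h (-(η : E × ℝ).2)‖ ≤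
        ∫ p : E × E, ‖V p‖ * (C * (1 + max 0 (R - ‖p.2‖))⁻¹) ∧
      HasSum (fun η : S => 𝓕 F (z - (η : E × ℝ).1) * h (-(η : E × ℝ).2))
        (∫ p : E × E, V p * ∑' η : S,
          𝓕 (tfShift p.1 p.2 g : E → ℂ) (z - (η : E × ℝ).1) * h (-(η : E × ℝ).2)) := by
  obtain ⟨C, hC0, hC⟩ := ZLattice.exists_tsum_norm_fourier_tfShift_mul_le L g h
  -- With `S` everything and `R = 0` this covers the full series; with `S` the exterior of a ball it
  -- covers the tails.
  refine ⟨C, fun z R S hS => ?_⟩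
  have hVB : Integrable fun p : E × E => ‖V p‖ * (C * (1 + max 0 (R - ‖p.2‖))⁻¹) := by
    have hne : ∀ p : E × E, 1 + max 0 (R - ‖p.2‖) ≠ 0 := fun p => by positivity
    refine hV.norm.mul_bdd (c := C) ?_ (.of_forall fun p => ?_)
    · exact (continuous_const.mul (Continuous.inv₀ (by fun_prop) hne)).aestronglyMeasurable
    · rw [Real.norm_of_nonneg (by positivity)]
      refine mul_le_of_le_one_right hC0 (inv_le_one_of_one_le₀ ?_)
      simp
  obtain ⟨hint, hs, hle⟩ := summable_integral_norm_mul_of_tsum_le (μ := volume) (V := V)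
    (K := fun (η : S) (p : E × E) =>
      𝓕 (tfShift p.1 p.2 g : E → ℂ) (z - (η : E × ℝ).1) * h (-(η : E × ℝ).2))
    hV.aestronglyMeasurable
    (fun η => ((continuous_fourier_tfShift g).comp (by fun_prop : Continuous fun p : E × E =>
      (p, z - (η : E × ℝ).1))).mul_const _ |>.aestronglyMeasurable)
    hVB (fun p => (hC p.1 p.2 z R S hS).1) (fun p => (hC p.1 p.2 z R S hS).2)
  have heq : ∀ η : S, 𝓕 F (z - (η : E × ℝ).1) * h (-(η : E × ℝ).2) = ∫ p : E × E, V p *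
      (𝓕 (tfShift p.1 p.2 g : E → ℂ) (z - (η : E × ℝ).1) * h (-(η : E × ℝ).2)) := by
    intro η
    rw [fourier_eq_integral_fourier_tfShift hV hF, ← integral_mul_const]
    simp only [mul_assoc]
  simp only [heq, ← tsum_mul_left]
  have hs' := hs.of_nonneg_of_le (fun _ => norm_nonneg _)
    fun η : S => norm_integral_le_integral_norm (μ := volume) fun p : E × E => V p *
      (𝓕 (tfShift p.1 p.2 g : E → ℂ) (z - (η : E × ℝ).1) * h (-(η : E × ℝ).2))
  exact ⟨hs', (hs'.tsum_le_tsum (fun _ => norm_integral_le_integral_norm _) hs).trans hle,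
    hasSum_integral_of_summable_integral_norm hint hs⟩

/-- Dominated convergence: the integrand is at most `|C| ‖V p‖` in modulus and tends to `0` for each
fixed frequency. -/
theorem tendsto_integral_norm_mul_inv_one_add_max (hV : Integrable V) (C : ℝ) :
    Tendsto (fun R : ℝ => ∫ p : E × E, ‖V p‖ * (C * (1 + max 0 (R - ‖p.2‖))⁻¹)) atTop (𝓝 0) := by
  rw [show 𝓝 (0 : ℝ) = 𝓝 (∫ _ : E × E, (0 : ℝ)) by simp]
  refine tendsto_integral_filter_of_dominated_convergence (fun p => ‖V p‖ * |C|)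
    (.of_forall fun R => ?_) (.of_forall fun R => .of_forall fun p => ?_) (hV.norm.mul_const _)
    (.of_forall fun p => ?_)
  · have hne : ∀ p : E × E, 1 + max 0 (R - ‖p.2‖) ≠ 0 := fun p => by positivity
    exact hV.aestronglyMeasurable.norm.mul
      (continuous_const.mul (Continuous.inv₀ (by fun_prop) hne)).aestronglyMeasurable
  · rw [norm_mul, norm_norm, norm_mul, Real.norm_eq_abs C]
    gcongr
    refine mul_le_of_le_one_right (abs_nonneg C) ?_
    rw [Real.norm_of_nonneg (by positivity)]
    exact inv_le_one_of_one_le₀ (by simp)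
  · have h1 : Tendsto (fun R : ℝ => 1 + max 0 (R - ‖p.2‖)) atTop atTop := by
      refine tendsto_atTop_mono (fun R => ?_) (tendsto_atTop_add_const_right _ (-‖p.2‖) tendsto_id)
      have := le_max_right 0 (R - ‖p.2‖)
      simp only [id]
      linarith
    simpa using (h1.inv_tendsto_atTop.const_mul C).const_mul ‖V p‖

/-- **Poisson summation** over a lattice in `E × ℝ` for an integrable superposition of
time-frequency shifts tensored with a Schwartz function. -/
theorem tsum_modChar_mul_of_eq_integral_tfShift (Γ : Submodule ℤ (E × ℝ)) [DiscreteTopology Γ]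
    [IsZLattice ℝ Γ] (h : 𝓢(ℝ, ℂ)) (hV : Integrable V)
    (hF : ∀ t, F t = ∫ p : E × E, V p * tfShift p.1 p.2 g t) (z : E) :
    ∑' γ : Γ, modChar (-z) (γ : E × ℝ).1 * (F (γ : E × ℝ).1 * h (γ : E × ℝ).2) =
      ((ZLattice.covolume Γ volume)⁻¹ : ℝ) * ∑' η : dualLattice Γ,
        𝓕 F (z - (η : E × ℝ).1) * 𝓕 (h : ℝ → ℂ) (-(η : E × ℝ).2) := by
  obtain ⟨C, hC⟩ := exists_hasSum_fourier_mul_of_eq_integral_tfShift (dualLattice Γ) (𝓕 h) hV hF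
  have hdual := (hC z 0 Set.univ fun _ _ => dist_nonneg).2.2.tsum_eq
  simp only [tsum_univ fun η : dualLattice Γ =>
    𝓕 F (z - (η : E × ℝ).1) * (𝓕 h) (-(η : E × ℝ).2)] at hdual
  rw [(hasSum_modChar_mul_of_eq_integral_tfShift Γ h hV hF z).2.tsum_eq]
  simp only [ZLattice.tsum_tfShift_mul]
  rw [SchwartzMap.fourier_coe] at hdual
  rw [hdual, ← integral_const_mul]
  refine integral_congr_ae (.of_forall fun p => ?_)
  simp only
  rw [tsum_univ fun η : dualLattice Γ => 𝓕 (tfShift p.1 p.2 g : E → ℂ) (z - (η : E × ℝ).1) *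
    𝓕 (h : ℝ → ℂ) (-(η : E × ℝ).2)]
  ring

end PoissonSuperposition

/-! ### From lattice sums to model sets -/

section ModelSets

variable {E : Type*} [NormedAddCommGroup E] {Γ : Submodule ℤ (E × ℝ)} {Ω : Set ℝ} {ψ : ℝ → ℝ}

/-- The points of a model set correspond to the lattice points above the window. -/
noncomputable def modelSetEquiv (hΓ : IsModelSetLattice Γ) (Ω : Set ℝ) :
    {γ : Γ | (γ : E × ℝ).2 ∈ Ω} ≃ modelSet Γ Ω :=
  Equiv.ofBijective (fun γ => ⟨((γ : Γ) : E × ℝ).1, (γ : Γ), (γ : Γ).2, γ.2, rfl⟩) <| by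
    constructor
    · intro γ γ' h
      exact Subtype.ext (Subtype.ext (hΓ.injOn_fst (γ : Γ).2 (γ' : Γ).2 (congrArg Subtype.val h)))
    · rintro ⟨l, γ, hγ, hΩ, rfl⟩
      exact ⟨⟨⟨γ, hγ⟩, hΩ⟩, rfl⟩

variable [InnerProductSpace ℝ E]

theorem modelSetTerm_modelSetEquiv (hΓ : IsModelSetLattice Γ) (F : E → ℂ)
    (γ : {γ : Γ | (γ : E × ℝ).2 ∈ Ω}) (z : E) :
    modelSetTerm Γ Ω ψ F (modelSetEquiv hΓ Ω γ) z =
      modChar (-z) ((γ : Γ) : E × ℝ).1 * (F ((γ : Γ) : E × ℝ).1 * ψ ((γ : Γ) : E × ℝ).2) := by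
  have h : ((modelSetEquiv hΓ Ω γ : modelSet Γ Ω) : E) = ((γ : Γ) : E × ℝ).1 := rfl
  rw [h, modelSetTerm, modelWeight_apply (Ω := Ω) hΓ ψ (γ : Γ).2 γ.2, modChar, inner_neg_left,
    real_inner_comm]
  push_cast
  ring_nf

/-- Lattice points whose second coordinate lies outside `Ω` contribute nothing, since `ψ` vanishes
there. -/
theorem tsum_modelSetTerm (hΓ : IsModelSetLattice Γ) (hψ : tsupport ψ ⊆ Ω) (F : E → ℂ) (z : E) :
    ∑' l : modelSet Γ Ω, modelSetTerm Γ Ω ψ F l z =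
      ∑' γ : Γ, modChar (-z) (γ : E × ℝ).1 * (F (γ : E × ℝ).1 * ψ (γ : E × ℝ).2) := by
  rw [← (modelSetEquiv hΓ Ω).tsum_eq]
  simp only [modelSetTerm_modelSetEquiv]
  refine tsum_subtype_eq_of_support_subset (f := fun γ : Γ =>
    modChar (-z) (γ : E × ℝ).1 * (F (γ : E × ℝ).1 * ψ (γ : E × ℝ).2)) fun γ hγ => ?_
  by_contra h
  refine hγ ?_
  have : ψ (γ : E × ℝ).2 = 0 := image_eq_zero_of_notMem_tsupport fun h' => h (hψ h')
  simp [this]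

/-- Independence of `z` turns absolute convergence at `0` into a Weierstrass majorant on the whole
space. -/
theorem norm_modelSetTerm (l z : E) (F : E → ℂ) :
    ‖modelSetTerm Γ Ω ψ F l z‖ = ‖(modelWeight Γ Ω ψ l : ℂ) * F l‖ := by
  have : -(2 * Real.pi * Complex.I * ((inner ℝ l z : ℝ) : ℂ)) =
      ((-(2 * Real.pi * inner ℝ l z) : ℝ) : ℂ) * Complex.I := by push_cast; ring
  rw [modelSetTerm, norm_mul, this, Complex.norm_exp_ofReal_mul_I, mul_one]

end ModelSets

/-- A family whose tails outside balls about `(z, 0)` are uniformly small converges uniformly on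
bounded sets. -/
theorem tendstoUniformlyOn_of_tsum_norm_dist_le {E : Type*} [NormedAddCommGroup E]
    [NormedSpace ℝ E] [FiniteDimensional ℝ E] (L : Submodule ℤ (E × ℝ)) [DiscreteTopology L]
    {f : L → E → ℂ} (hs : ∀ z, Summable fun η => ‖f η z‖)
    (htail : ∀ ε : ℝ, 0 < ε → ∃ R : ℝ, ∀ z : E,
      ∑' η : {η : L // R < dist (η : E × ℝ) (z, 0)}, ‖f η z‖ ≤ ε)
    {K : Set E} (hK : Bornology.IsBounded K) :
    TendstoUniformlyOn (fun (s : Finset L) z => ∑ η ∈ s, f η z) (fun z => ∑' η, f η z) atTop K := by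
  rw [Metric.tendstoUniformlyOn_iff]
  intro ε hε
  obtain ⟨R, hR⟩ := htail (ε / 2) (half_pos hε)
  obtain ⟨M, hM⟩ := hK.exists_norm_le
  have hfin : {η : L | ‖(η : E × ℝ)‖ ≤ R + M}.Finite := by
    have hcl : IsClosed (L : Set (E × ℝ)) :=
      @AddSubgroup.isClosed_of_discrete _ _ _ _ _ L.toAddSubgroup (inferInstanceAs
        (DiscreteTopology L))
    refine ((Metric.finite_isBounded_inter_isClosed DiscreteTopology.isDiscrete
      (Metric.isBounded_closedBall (x := (0 : E × ℝ)) (r := R + M)) hcl).preimage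
      Subtype.val_injective.injOn).subset fun η hη => ?_
    exact ⟨by simpa using hη, η.2⟩
  -- Once `s` contains the finitely many lattice points of norm at most `R + M`, every omitted point
  -- is farther than `R` from `(z, 0)` whenever `‖z‖ ≤ M`.
  filter_upwards [eventually_ge_atTop hfin.toFinset] with s hsub z hz
  have hsum := (hs z).of_norm
  rw [dist_eq_norm, ← hsum.sum_add_tsum_subtype_compl s, add_sub_cancel_left]
  refine lt_of_le_of_lt (norm_tsum_le_tsum_norm ((hs z).subtype _)) ?_
  refine lt_of_le_of_lt (le_trans ?_ (hR z)) (half_lt_self hε)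
  have hsubset : {η : L | η ∉ s} ⊆ {η : L | R < dist (η : E × ℝ) (z, 0)} := by
    intro η hη
    have h1 : R + M < ‖(η : E × ℝ)‖ := by
      by_contra! h
      exact hη (hsub (by simpa using h))
    have h2 : ‖((z, 0) : E × ℝ)‖ = ‖z‖ := by simp [Prod.norm_def]
    have h3 := norm_sub_norm_le (η : E × ℝ) (z, 0)
    rw [h2] at h3
    have h4 := hM z hz
    change R < dist (η : E × ℝ) (z, 0)
    rw [dist_eq_norm]
    linarith
  change ∑' η : {η : L | η ∉ s}, ‖f η z‖ ≤ ∑' η : {η : L | R < dist (η : E × ℝ) (z, 0)}, ‖f η z‖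
  rw [tsum_subtype {η : L | η ∉ s} fun η => ‖f η z‖,
    tsum_subtype {η : L | R < dist (η : E × ℝ) (z, 0)} fun η => ‖f η z‖]
  exact ((hs z).indicator _).tsum_le_tsum
    (Set.indicator_le_indicator_of_subset hsubset fun η => norm_nonneg _) ((hs z).indicator _)


/-! ### Poisson summation for simple model sets -/

theorem mainTheorem8 (d : ℕ)
    (Γ : Submodule ℤ (EuclideanSpace ℝ (Fin (2 * d)) × ℝ)) [DiscreteTopology Γ] [IsZLattice ℝ Γ]
    (hΓ : IsModelSetLattice Γ)
    (Ω : Set ℝ) (hΩ : IsCompact (closure Ω)) (hΩ' : (interior Ω).Nonempty)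
    (ψ : ℝ → ℝ) (hψ : ContDiff ℝ ∞ ψ) (hψΩ : tsupport ψ ⊆ Ω)
    (F : EuclideanSpace ℝ (Fin (2 * d)) → ℂ) (hF : MemM1 F) :
    -- `F` is integrable, so that its Fourier transform is given by the integral
    Integrable F volume ∧
    -- the identity holds pointwise
    (∀ z : EuclideanSpace ℝ (Fin (2 * d)),
      ∑' l : modelSet Γ Ω, modelSetTerm Γ Ω ψ F l z =
        ∑' η : dualLattice Γ, dualTerm Γ ψ F η z) ∧
    -- both series converge absolutely at every point
    (∀ z : EuclideanSpace ℝ (Fin (2 * d)),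
      Summable (fun l : modelSet Γ Ω => ‖modelSetTerm Γ Ω ψ F l z‖)) ∧
    (∀ z : EuclideanSpace ℝ (Fin (2 * d)),
      Summable (fun η : dualLattice Γ => ‖dualTerm Γ ψ F η z‖)) ∧
    -- the left-hand series converges uniformly on the whole space
    TendstoUniformly
      (fun (s : Finset (modelSet Γ Ω)) (z : EuclideanSpace ℝ (Fin (2 * d))) =>
        ∑ l ∈ s, modelSetTerm Γ Ω ψ F l z)
      (fun z => ∑' l : modelSet Γ Ω, modelSetTerm Γ Ω ψ F l z) atTop ∧
    -- the right-hand series converges uniformly on compact sets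
    (∀ K : Set (EuclideanSpace ℝ (Fin (2 * d))), IsCompact K →
      TendstoUniformlyOn
        (fun (s : Finset (dualLattice Γ)) (z : EuclideanSpace ℝ (Fin (2 * d))) =>
          ∑ η ∈ s, dualTerm Γ ψ F η z)
        (fun z => ∑' η : dualLattice Γ, dualTerm Γ ψ F η z) atTop K) ∧
    -- and its tails, outside balls about `(z, 0)`, are small uniformly in `z` on the whole space
    (∀ ε : ℝ, 0 < ε → ∃ R : ℝ, ∀ z : EuclideanSpace ℝ (Fin (2 * d)),
      ∑' η : {η : dualLattice Γ // R < dist (η : EuclideanSpace ℝ (Fin (2 * d)) × ℝ) (z, 0)},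
        ‖dualTerm Γ ψ F (η : dualLattice Γ) z‖ ≤ ε) := by
  obtain ⟨g, V, hV, hFV⟩ := hF.exists_eq_integral_tfShift
  -- Relative compactness of `Ω` makes `ψ` a test function, hence a Schwartz function.
  have hcs : HasCompactSupport ψ :=
    hΩ.of_isClosed_subset (isClosed_tsupport ψ) (hψΩ.trans subset_closure)
  have hcs' : HasCompactSupport fun t => (ψ t : ℂ) :=
    hcs.comp_left (g := fun x : ℝ => (x : ℂ)) Complex.ofReal_zero
  let h : 𝓢(ℝ, ℂ) := hcs'.toSchwartzMap (Complex.ofRealCLM.contDiff.comp hψ)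
  have hh : (h : ℝ → ℂ) = fun t => (ψ t : ℂ) := rfl
  have hleft : ∀ z, Summable fun l : modelSet Γ Ω => ‖modelSetTerm Γ Ω ψ F l z‖ := by
    intro z
    rw [← (modelSetEquiv hΓ Ω).summable_iff]
    simp only [Function.comp_def, modelSetTerm_modelSetEquiv]
    exact (hasSum_modChar_mul_of_eq_integral_tfShift Γ h hV hFV z).1.subtype _
  set c : ℂ := (((ZLattice.covolume Γ volume)⁻¹ : ℝ) : ℂ)
  have hterm : ∀ (η : dualLattice Γ) z, dualTerm Γ ψ F η z =
      c * (𝓕 F (z - η.1.1) * (𝓕 h) (-η.1.2)) := by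
    intro η z
    rw [dualTerm, dualWeight, SchwartzMap.fourier_coe, hh]
    ring
  obtain ⟨C, hC⟩ := exists_hasSum_fourier_mul_of_eq_integral_tfShift (dualLattice Γ) (𝓕 h) hV hFV
  have hright : ∀ z, Summable fun η : dualLattice Γ => ‖dualTerm Γ ψ F η z‖ := by
    intro z
    have := (hC z 0 Set.univ fun _ _ => dist_nonneg).1
    simp only [hterm, norm_mul c]
    refine Summable.mul_left _ ?_
    exact (Equiv.Set.univ (dualLattice Γ)).symm.summable_iff.mpr this
  have htail : ∀ ε : ℝ, 0 < ε → ∃ R : ℝ, ∀ z : EuclideanSpace ℝ (Fin (2 * d)),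
      ∑' η : {η : dualLattice Γ // R < dist (η : EuclideanSpace ℝ (Fin (2 * d)) × ℝ) (z, 0)},
        ‖dualTerm Γ ψ F (η : dualLattice Γ) z‖ ≤ ε := by
    intro ε hε
    have hlim := (tendsto_integral_norm_mul_inv_one_add_max hV C).const_mul ‖c‖
    rw [mul_zero] at hlim
    -- The dominating integral does not involve `z`, so neither does `R`.
    obtain ⟨R, hR⟩ := (hlim.eventually (gt_mem_nhds hε)).exists
    refine ⟨R, fun z => ?_⟩
    simp only [hterm, norm_mul c]
    rw [tsum_mul_left]
    refine le_trans ?_ hR.le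
    gcongr
    exact (hC z R {η | R < dist (η : EuclideanSpace ℝ (Fin (2 * d)) × ℝ) (z, 0)}
      fun η hη => le_of_lt hη).2.1
  refine ⟨integrable_of_eq_integral_tfShift hV hFV, fun z => ?_, hleft, hright, ?_,
    fun K hK => tendstoUniformlyOn_of_tsum_norm_dist_le _ hright htail hK.isBounded, htail⟩
  · rw [tsum_modelSetTerm hΓ hψΩ]
    simp only [hterm, tsum_mul_left]
    exact tsum_modChar_mul_of_eq_integral_tfShift Γ h hV hFV z
  · have h0 := hleft 0
    simp only [norm_modelSetTerm] at h0
    exact tendstoUniformly_tsum h0 fun l z => (norm_modelSetTerm _ _ _).le
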